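/- Let $H$ be a separable, infinite-dimensional real or complex Hilbert space, and let $A$ be a positive bounded operator on $H$ (that is, $A$ is self-adjoint and $\langle Ax,x\rangle\ge 0$ for all $x\in H$; $A$ need not be invertible). Suppose that its essential norm $$\|A\|_{ess}:=\inf\{\|A-K\| : K \text{ a compact operator on } H\}$$ satisfies $\|A\|_{ess}>1$. Then $A$ has a projection decomposition: there is a finite or infinite sequence of (not necessarily mutually orthogonal) self-adjoint projections $P_i$ on $H$ such that $A=\sum_i P_i$, where, if the sequence is infinite, the series converges in the strong operator topology, i.e. $\sum_{i\le n}P_ix\to Ax$ for every $x\in H$. -/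

import Mathlib

open Filter Topology

noncomputable section

/-- The essential norm of a bounded operator: the infimum of `‖B - K‖` over all compact
operators `K`. -/
def essNorm {𝕜 H : Type*} [RCLike 𝕜] [NormedAddCommGroup H] [InnerProductSpace 𝕜 H]
    (B : H →L[𝕜] H) : ℝ :=
  ⨅ K : {K : H →L[𝕜] H // IsCompactOperator K}, ‖B - K‖

/-- The series `∑ P i` converges to `A` in the strong operator topology, i.e. its partial sums
converge to `A` in the topology of pointwise convergence on `H`. -/
def SumsStronglyTo {𝕜 H : Type*} [RCLike 𝕜] [NormedAddCommGroup H] [InnerProductSpace 𝕜 H]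
    (P : ℕ → H →L[𝕜] H) (A : H →L[𝕜] H) : Prop :=
  Tendsto
    (fun n : ℕ => ContinuousLinearMap.toPointwiseConvergenceCLM 𝕜 (RingHom.id 𝕜) H H
      (∑ i ∈ Finset.range n, P i))
    atTop (𝓝 (ContinuousLinearMap.toPointwiseConvergenceCLM 𝕜 (RingHom.id 𝕜) H H A))

/-- `A` has a projection decomposition if it is the sum of a finite or infinite sequence of
(not necessarily mutually orthogonal) self-adjoint projections, an infinite sum being understood
in the strong operator topology. -/
def HasProjectionDecomposition {𝕜 H : Type*} [RCLike 𝕜] [NormedAddCommGroup H]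
    [InnerProductSpace 𝕜 H] [CompleteSpace H] (A : H →L[𝕜] H) : Prop :=
  (∃ (n : ℕ) (P : Fin n → H →L[𝕜] H), (∀ i, IsStarProjection (P i)) ∧ A = ∑ i, P i) ∨
  (∃ P : ℕ → H →L[𝕜] H, (∀ i, IsStarProjection (P i)) ∧ SumsStronglyTo P A)

end

section ProjectionDecomposition

variable {𝕜 H : Type*} [RCLike 𝕜] [NormedAddCommGroup H] [InnerProductSpace 𝕜 H]

/-- The Cauchy–Schwarz inequality for the semi-inner product `⟪R x, y⟫` of a positive operator. -/
theorem ContinuousLinearMap.IsPositive.norm_inner_sq_le {R : H →L[𝕜] H} (hR : R.IsPositive)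
    (x y : H) :
    ‖inner 𝕜 (R x) y‖ ^ 2 ≤ RCLike.re (inner 𝕜 (R x) x) * RCLike.re (inner 𝕜 (R y) y) := by
  let c : PreInnerProductSpace.Core 𝕜 H :=
    { inner := fun x y => inner 𝕜 (R x) y
      conj_inner_symm := fun x y => by
        rw [inner_conj_symm, hR.inner_left_eq_inner_right]
      re_inner_nonneg := fun x => hR.re_inner_nonneg_left x
      add_left := fun x y z => by simp [inner_add_left]
      smul_left := fun x y r => by simp [inner_smul_left] }
  have h := @InnerProductSpace.Core.inner_mul_inner_self_le 𝕜 H _ _ _ c x y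
  have h' : ‖inner 𝕜 (R x) y‖ * ‖inner 𝕜 (R y) x‖
      ≤ RCLike.re (inner 𝕜 (R x) x) * RCLike.re (inner 𝕜 (R y) y) := h
  rwa [hR.inner_left_eq_inner_right y x, norm_inner_symm y (R x), ← sq] at h'

/-- If `0 ≤ R ≤ A` then `‖R x‖ ^ 2 ≤ ‖A‖ ⟪R x, x⟫`. -/
theorem ContinuousLinearMap.IsPositive.norm_apply_sq_le {R A : H →L[𝕜] H} (hR : R.IsPositive)
    (hRA : (A - R).IsPositive) (x : H) :
    ‖R x‖ ^ 2 ≤ ‖A‖ * RCLike.re (inner 𝕜 (R x) x) := by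
  rcases eq_or_ne (R x) 0 with h0 | h0
  · simp [h0]
  have hpos : 0 < ‖R x‖ ^ 2 := by positivity
  have hcs := hR.norm_inner_sq_le x (R x)
  have hq := hR.re_inner_nonneg_left x
  have hle : RCLike.re (inner 𝕜 (R (R x)) (R x)) ≤ ‖A‖ * ‖R x‖ ^ 2 := by
    have h1 := hRA.re_inner_nonneg_left (R x)
    rw [sub_apply, inner_sub_left, map_sub, sub_nonneg] at h1
    have h2 := re_inner_le_norm (𝕜 := 𝕜) (A (R x)) (R x)
    have h3 := mul_le_mul_of_nonneg_right (A.le_opNorm (R x)) (norm_nonneg (R x))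
    nlinarith
  have hn : ‖inner 𝕜 (R x) (R x)‖ = ‖R x‖ ^ 2 := by
    rw [inner_self_eq_norm_sq_to_K]; simp
  rw [hn] at hcs
  have h4 := hcs.trans (mul_le_mul_of_nonneg_left hle hq)
  refine le_of_mul_le_mul_right ?_ hpos
  linarith

/-- If `0 ≤ R ≤ A` then `‖R x‖ ≤ ‖A‖ ‖x‖`. -/
theorem ContinuousLinearMap.IsPositive.norm_apply_le {R A : H →L[𝕜] H} (hR : R.IsPositive)
    (hRA : (A - R).IsPositive) (x : H) : ‖R x‖ ≤ ‖A‖ * ‖x‖ := by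
  rcases eq_or_ne (R x) 0 with h0 | h0
  · rw [h0, norm_zero]; positivity
  have hpos : 0 < ‖R x‖ := norm_pos_iff.2 h0
  have h1 := hR.norm_apply_sq_le hRA x
  have h2 := mul_le_mul_of_nonneg_left (re_inner_le_norm (𝕜 := 𝕜) (R x) x) (norm_nonneg A)
  refine le_of_mul_le_mul_right ?_ hpos
  linarith

/-- Below the essential norm of `A`, no subspace of finite codimension bounds `A`. -/
theorem exists_mem_orthogonal_of_lt_essNorm {A : H →L[𝕜] H} {c : ℝ} (hc : 0 ≤ c)
    (h : c < essNorm A) (F : Submodule 𝕜 H) [FiniteDimensional 𝕜 F] :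
    ∃ z ∈ Fᗮ, c * ‖z‖ < ‖A z‖ := by
  by_contra! hcon
  have hK : IsCompactOperator (A ∘L F.starProjection) := by
    have : IsCompactOperator F.orthogonalProjectionOnto :=
      isCompactOperator_of_locallyCompactSpace_dom F.orthogonalProjectionOnto
    exact this.clm_comp (A ∘L F.subtypeL)
  have hb : BddBelow (Set.range
      fun K : {K : H →L[𝕜] H // IsCompactOperator K} => ‖A - K‖) :=
    ⟨0, by rintro _ ⟨K, rfl⟩; exact norm_nonneg _⟩
  have h1 : essNorm A ≤ ‖A - A ∘L F.starProjection‖ := ciInf_le hb ⟨_, hK⟩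
  have h2 : ‖A - A ∘L F.starProjection‖ ≤ c := by
    refine ContinuousLinearMap.opNorm_le_bound _ hc fun x => ?_
    have h3 : (A - A ∘L F.starProjection) x = A (Fᗮ.starProjection x) := by
      rw [Submodule.starProjection_orthogonal_val]; simp
    rw [h3]
    exact (hcon _ (Submodule.starProjection_apply_mem _ _)).trans
      (mul_le_mul_of_nonneg_left (Submodule.norm_starProjection_apply_le _ _) hc)
  linarith

/-- A rank-one projection `P ≤ R`, onto the span of `R y`, whose removal shrinks `⟪R x, x⟫`. -/
theorem exists_isStarProjection_sub_isPositive [CompleteSpace H] {R : H →L[𝕜] H}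
    (hR : R.IsPositive) {x y : H} {K : ℝ} (hxy : inner 𝕜 (R x) y = inner 𝕜 (R x) x)
    (hy0 : R y ≠ 0) (hy : RCLike.re (inner 𝕜 (R y) y) ≤ ‖R y‖ ^ 2)
    (hK : ‖R y‖ ^ 2 ≤ K * RCLike.re (inner 𝕜 (R x) x)) :
    ∃ P : H →L[𝕜] H, IsStarProjection P ∧ (R - P).IsPositive ∧
      (∀ z, inner 𝕜 (R y) z = 0 → P z = 0) ∧
      K * RCLike.re (inner 𝕜 ((R - P) x) x) ≤ (K - 1) * RCLike.re (inner 𝕜 (R x) x) := by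
  have hn : 0 < ‖R y‖ ^ 2 := by positivity
  have hP : IsStarProjection (𝕜 ∙ R y).starProjection := isStarProjection_starProjection
  have hPin : ∀ z, RCLike.re (inner 𝕜 ((𝕜 ∙ R y).starProjection z) z)
      = ‖inner 𝕜 (R y) z‖ ^ 2 / ‖R y‖ ^ 2 := fun z => by
    rw [Submodule.starProjection_singleton, inner_smul_left, map_div₀, inner_conj_symm,
      RCLike.conj_ofReal, div_mul_eq_mul_div, RCLike.div_re_ofReal, inner_mul_symm_re_eq_norm,
      norm_mul, norm_inner_symm z, ← sq]
  refine ⟨_, hP, ?_, fun z hz => ?_, ?_⟩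
  · refine ContinuousLinearMap.isPositive_def'.2 ⟨hR.isSelfAdjoint.sub hP.isSelfAdjoint, fun z => ?_⟩
    rw [ContinuousLinearMap.reApplyInnerSelf_apply, sub_apply, inner_sub_left,
      map_sub, hPin, sub_nonneg, div_le_iff₀ hn, mul_comm]
    exact (hR.norm_inner_sq_le y z).trans
      (mul_le_mul_of_nonneg_right hy (hR.re_inner_nonneg_left z))
  · rw [Submodule.starProjection_singleton, hz]; simp
  · rw [sub_apply, inner_sub_left, map_sub, hPin,
      hR.inner_left_eq_inner_right y x, norm_inner_symm y, hxy]
    have h1 : RCLike.re (inner 𝕜 (R x) x) ≤ ‖inner 𝕜 (R x) x‖ := RCLike.re_le_norm _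
    have h0 := hR.re_inner_nonneg_left x
    set q := RCLike.re (inner 𝕜 (R x) x)
    have h2 : q * ‖R y‖ ^ 2 ≤ K * q ^ 2 := by nlinarith
    have hKq : 0 < K := by
      by_contra! hneg
      nlinarith
    have h3 : q ≤ K * (‖inner 𝕜 (R x) x‖ ^ 2 / ‖R y‖ ^ 2) := by
      rw [mul_div_assoc', le_div_iff₀ hn]
      exact h2.trans (by gcongr)
    linarith

/-- `R` is a positive operator obtained from `A` by subtracting a positive operator that vanishes
on a subspace of finite codimension. -/
structure IsFiniteRankRemainder (A R : H →L[𝕜] H) : Prop where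
  isPositive : R.IsPositive
  sub_isPositive : (A - R).IsPositive
  exists_eq_on : ∃ F : Submodule 𝕜 H, FiniteDimensional 𝕜 F ∧ ∀ z ∈ Fᗮ, R z = A z

/-- One step of the decomposition: subtracting a suitable projection from the remainder `R`
shrinks `⟪R x, x⟫` by a factor that does not depend on `R` and `x`. -/
theorem IsFiniteRankRemainder.exists_isStarProjection [CompleteSpace H] {A R : H →L[𝕜] H} {ε K : ℝ}
    (hε : 0 < ε) (hess : 1 + ε < essNorm A) (hKA : ‖A‖ ≤ K) (hKε : 1 + 1 / ε ≤ K)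
    (hR : IsFiniteRankRemainder A R) (x : H) :
    ∃ P : H →L[𝕜] H, IsStarProjection P ∧ IsFiniteRankRemainder A (R - P) ∧
      K * RCLike.re (inner 𝕜 ((R - P) x) x) ≤ (K - 1) * RCLike.re (inner 𝕜 (R x) x) := by
  have hpos := hR.isPositive
  obtain ⟨F, hF, hRF⟩ := hR.exists_eq_on
  have hq0 := hpos.re_inner_nonneg_left x
  have hM := hpos.norm_apply_sq_le hR.sub_isPositive
  rcases eq_or_ne (R x) 0 with h0 | h0
  · exact ⟨0, IsStarProjection.zero _, by simpa using hR, by simp [h0]⟩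
  suffices h : ∃ y, inner 𝕜 (R x) y = inner 𝕜 (R x) x ∧ R y ≠ 0 ∧
      RCLike.re (inner 𝕜 (R y) y) ≤ ‖R y‖ ^ 2 ∧
      ‖R y‖ ^ 2 ≤ K * RCLike.re (inner 𝕜 (R x) x) by
    obtain ⟨y, hxy, hy0, hy, hyK⟩ := h
    obtain ⟨P, hP, hRP, hPz, hdec⟩ := exists_isStarProjection_sub_isPositive hpos hxy hy0 hy hyK
    refine ⟨P, hP, ⟨hRP, ?_, F ⊔ 𝕜 ∙ R y, inferInstance, fun z hz => ?_⟩, hdec⟩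
    · rw [show A - (R - P) = (A - R) + P by abel]
      exact hR.sub_isPositive.add (.of_isStarProjection hP)
    · rw [← Submodule.inf_orthogonal] at hz
      rw [sub_apply, hRF z hz.1,
        hPz z (Submodule.mem_orthogonal_singleton_iff_inner_right.1 hz.2), sub_zero]
  have hnx : 0 < ‖R x‖ ^ 2 := by positivity
  rcases le_or_gt (RCLike.re (inner 𝕜 (R x) x)) (‖R x‖ ^ 2) with hx | hx
  · exact ⟨x, rfl, h0, hx, (hM x).trans (mul_le_mul_of_nonneg_right hKA hq0)⟩
  obtain ⟨z, hz, hAz⟩ := exists_mem_orthogonal_of_lt_essNorm (by positivity) hess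
    (F ⊔ (𝕜 ∙ R x) ⊔ 𝕜 ∙ R (R x))
  rw [← Submodule.inf_orthogonal, ← Submodule.inf_orthogonal] at hz
  have hz1 := Submodule.mem_orthogonal_singleton_iff_inner_right.1 hz.1.2
  have hz2 := Submodule.mem_orthogonal_singleton_iff_inner_right.1 hz.2
  rw [← hRF z hz.1.1] at hAz
  rw [hpos.inner_left_eq_inner_right] at hz2
  have hzx : inner 𝕜 (R z) x = 0 := by
    rw [hpos.inner_left_eq_inner_right, inner_eq_zero_symm]; exact hz1
  have hRz0 : 0 < ‖R z‖ := lt_of_le_of_lt (by positivity) hAz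
  have hqz := hpos.re_inner_nonneg_left z
  have hqz' : (1 + ε) * RCLike.re (inner 𝕜 (R z) z) ≤ ‖R z‖ ^ 2 := by
    have h1 := re_inner_le_norm (𝕜 := 𝕜) (R z) z
    nlinarith
  have hqz0 : 0 < RCLike.re (inner 𝕜 (R z) z) := by
    refine hqz.lt_of_ne fun h => ?_
    have := hM z
    rw [← h, mul_zero] at this
    nlinarith
  set q := RCLike.re (inner 𝕜 (R x) x)
  set r := RCLike.re (inner 𝕜 (R z) z)
  have hden : 0 < ‖R z‖ ^ 2 - r := by nlinarith
  set s := (q - ‖R x‖ ^ 2) / (‖R z‖ ^ 2 - r)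
  have hs0 : 0 < s := div_pos (by linarith) hden
  have hseq : s * (‖R z‖ ^ 2 - r) = q - ‖R x‖ ^ 2 := div_mul_cancel₀ _ hden.ne'
  have ht : ‖((√s : ℝ) : 𝕜)‖ ^ 2 = s := by
    rw [RCLike.norm_ofReal, sq_abs, Real.sq_sqrt hs0.le]
  have hny : ‖R (x + ((√s : ℝ) : 𝕜) • z)‖ ^ 2 = ‖R x‖ ^ 2 + s * ‖R z‖ ^ 2 := by
    rw [map_add, map_smul, sq, norm_add_sq_eq_norm_sq_add_norm_sq_of_inner_eq_zero _ _
      (by rw [inner_smul_right, hz2, mul_zero]), norm_smul]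
    linear_combination ‖R z‖ ^ 2 * ht
  have hqy : RCLike.re (inner 𝕜 (R (x + ((√s : ℝ) : 𝕜) • z)) (x + ((√s : ℝ) : 𝕜) • z))
      = q + s * r := by
    have : (inner 𝕜 (((√s : ℝ) : 𝕜) • R z) (((√s : ℝ) : 𝕜) • z)) = (s : 𝕜) * inner 𝕜 (R z) z := by
      rw [inner_smul_left, inner_smul_right, RCLike.conj_ofReal, ← mul_assoc, ← RCLike.ofReal_mul,
        Real.mul_self_sqrt hs0.le]
    rw [map_add, map_smul, inner_add_left, inner_add_right, inner_add_right, this,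
      inner_smul_right, hz1, inner_smul_left, hzx, mul_zero, mul_zero, add_zero, zero_add, map_add,
      RCLike.re_ofReal_mul]
  refine ⟨x + ((√s : ℝ) : 𝕜) • z, ?_, fun h => ?_, ?_, ?_⟩
  · rw [inner_add_right, inner_smul_right, hz1, mul_zero, add_zero]
  · rw [h, norm_zero] at hny
    nlinarith
  · rw [hny, hqy]; linarith
  · have h1 : s * r ≤ q * (1 / ε) := by
      rw [mul_one_div, le_div_iff₀ hε]
      nlinarith
    have h2 := mul_le_mul_of_nonneg_right hKε hq0
    rw [hny]
    linarith

/-- An antitone sequence of nonnegative reals that drops infinitely often by a fixed factor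
tends to zero. -/
theorem tendsto_zero_of_antitone_of_frequently_mul_le {u : ℕ → ℝ} {K : ℝ} (hu : Antitone u)
    (h0 : ∀ n, 0 ≤ u n) {φ : ℕ → ℕ} (hφ : Tendsto φ atTop atTop)
    (h : ∀ m, K * u (φ m + 1) ≤ (K - 1) * u (φ m)) : Tendsto u atTop (𝓝 0) := by
  obtain ⟨l, hl⟩ : ∃ l, Tendsto u atTop (𝓝 l) :=
    ⟨_, tendsto_atTop_ciInf hu ⟨0, by rintro _ ⟨n, rfl⟩; exact h0 n⟩⟩
  have hl0 : 0 ≤ l := ge_of_tendsto' hl h0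
  have h1 := le_of_tendsto_of_tendsto' (((hl.comp (tendsto_add_atTop_nat 1)).comp hφ).const_mul K)
    ((hl.comp hφ).const_mul (K - 1)) h
  rwa [show l = 0 by linarith] at hl

theorem sumsStronglyTo_iff {P : ℕ → H →L[𝕜] H} {A : H →L[𝕜] H} :
    SumsStronglyTo P A ↔ ∀ x, Tendsto (fun n => ∑ i ∈ Finset.range n, P i x) atTop (𝓝 (A x)) := by
  rw [SumsStronglyTo, PointwiseConvergenceCLM.tendsto_iff_forall_tendsto]
  exact forall_congr' fun x => tendsto_congr fun n => sum_apply (Finset.range n) P x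

/-- Operators that are uniformly bounded and tend to zero on a dense sequence tend to zero
strongly. -/
theorem tendsto_apply_zero_of_denseRange {R : ℕ → H →L[𝕜] H} {M : ℝ}
    (hM : ∀ n x, ‖R n x‖ ≤ M * ‖x‖) {d : ℕ → H} (hd : DenseRange d)
    (h : ∀ k, Tendsto (fun n => R n (d k)) atTop (𝓝 0)) (x : H) :
    Tendsto (fun n => R n x) atTop (𝓝 0) := by
  rw [Metric.tendsto_atTop]
  intro η hη
  obtain ⟨k, hk⟩ := hd.exists_dist_lt x (show 0 < η / (2 * (|M| + 1)) by positivity)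
  obtain ⟨N, hN⟩ := Metric.tendsto_atTop.1 (h k) (η / 2) (by positivity)
  refine ⟨N, fun n hn => ?_⟩
  have h1 := hN n hn
  rw [dist_zero_right] at h1 ⊢
  rw [dist_eq_norm, lt_div_iff₀ (by positivity)] at hk
  have h2 := hM n (x - d k)
  have h3 : ‖R n x‖ ≤ ‖R n (x - d k)‖ + ‖R n (d k)‖ := by
    simpa using norm_add_le (R n (x - d k)) (R n (d k))
  have h4 := mul_le_mul_of_nonneg_right (le_abs_self M) (norm_nonneg (x - d k))
  nlinarith [norm_nonneg (x - d k)]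

end ProjectionDecomposition

theorem theorem2 {𝕜 H : Type*} [RCLike 𝕜] [NormedAddCommGroup H] [InnerProductSpace 𝕜 H]
    [CompleteSpace H] [TopologicalSpace.SeparableSpace H]
    (hdim : ¬ FiniteDimensional 𝕜 H)
    (A : H →L[𝕜] H) (hA : A.IsPositive) (hess : 1 < essNorm A) :
    HasProjectionDecomposition A := by
  obtain ⟨c, hc1, hc⟩ := exists_between hess
  obtain ⟨ε, hε, rfl⟩ : ∃ ε, 0 < ε ∧ 1 + ε = c := ⟨c - 1, by linarith, by ring⟩
  set K := max ‖A‖ (1 + 1 / ε)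
  choose P hP hrem hdec using fun (R : {R : H →L[𝕜] H // IsFiniteRankRemainder A R}) (x : H) =>
    R.2.exists_isStarProjection hε hc (le_max_left _ _ : ‖A‖ ≤ K) (le_max_right _ _) x
  let d := TopologicalSpace.denseSeq H
  have hA0 : IsFiniteRankRemainder A A :=
    ⟨hA, by simp, ⊥, inferInstance, fun _ _ => rfl⟩
  let R : ℕ → {R : H →L[𝕜] H // IsFiniteRankRemainder A R} := fun n =>
    Nat.rec ⟨A, hA0⟩ (fun n R => ⟨R - P R (d n.unpair.1), hrem R (d n.unpair.1)⟩) n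
  let Q : ℕ → H →L[𝕜] H := fun n => P (R n) (d n.unpair.1)
  have hstep : ∀ n, (R (n + 1)).1 = (R n).1 - Q n := fun n => rfl
  have hsum : ∀ n, ∑ i ∈ Finset.range n, Q i = A - (R n).1 := by
    intro n
    induction n with
    | zero => simp [R]
    | succ n ih => rw [Finset.sum_range_succ, ih, hstep]; abel
  refine Or.inr ⟨Q, fun n => hP _ _, sumsStronglyTo_iff.2 fun x => ?_⟩
  have hzero : Tendsto (fun n => (R n).1 x) atTop (𝓝 0) := by
    refine tendsto_apply_zero_of_denseRange
      (fun n => (R n).2.isPositive.norm_apply_le (R n).2.sub_isPositive)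
      (TopologicalSpace.denseRange_denseSeq H) (fun k => ?_) x
    have hform : Tendsto (fun n => RCLike.re (inner 𝕜 ((R n).1 (d k)) (d k)))
        atTop (𝓝 0) := by
      refine tendsto_zero_of_antitone_of_frequently_mul_le (K := K) (φ := Nat.pair k)
        (antitone_nat_of_succ_le fun n => ?_)
        (fun n => (R n).2.isPositive.re_inner_nonneg_left _)
        (tendsto_atTop_mono (Nat.right_le_pair k) tendsto_id) fun m => ?_
      · rw [hstep, sub_apply, inner_sub_left, map_sub, sub_le_self_iff]
        exact (ContinuousLinearMap.IsPositive.of_isStarProjection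
          (hP (R n) (d n.unpair.1))).re_inner_nonneg_left _
      · have := hdec (R (Nat.pair k m)) (d (Nat.pair k m).unpair.1)
        rw [hstep]
        simp only [Q]
        rwa [Nat.unpair_pair] at this ⊢
    have hsq : Tendsto (fun n => ‖(R n).1 (d k)‖ ^ 2) atTop (𝓝 0) :=
      squeeze_zero (fun n => by positivity)
        (fun n => (R n).2.isPositive.norm_apply_sq_le (R n).2.sub_isPositive (d k))
        (by simpa using hform.const_mul ‖A‖)
    rw [tendsto_zero_iff_norm_tendsto_zero]
    simpa using hsq.sqrt
  have := (tendsto_const_nhds (x := A x)).sub hzero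
  rw [sub_zero] at this
  refine this.congr fun n => ?_
  rw [← sum_apply, hsum, sub_apply]
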